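/- A polytope in $\mathbb{R}^n$ is the convex hull of a finite set of points, and a $4$-polytope is a polytope whose affine hull has dimension $4$. The graph $G(P)$ of a polytope $P$ is the undirected graph whose vertices are the vertices ($0$-dimensional faces) of $P$, two distinct vertices being adjacent when the segment joining them is an edge ($1$-dimensional face) of $P$. A graph is $k$-linked if it has at least $2k$ vertices and, for every choice of $2k$ pairwise distinct vertices $s_1,\dots,s_k,t_1,\dots,t_k$, there are pairwise vertex-disjoint paths $L_1,\dots,L_k$ such that $L_i$ joins $s_i$ to $t_i$ for $i=1,\dots,k$. **Proposition (2-linkedness of 4-polytopes).** For every $n$, the graph of every $4$-polytope $P\subset\mathbb{R}^n$ is $2$-linked. -/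

import Mathlib

/-- A convex polytope in `ℝⁿ`: the convex hull of a finite set of points. -/
def IsPolytope {n : ℕ} (P : Set (EuclideanSpace ℝ (Fin n))) : Prop :=
  ∃ S : Finset (EuclideanSpace ℝ (Fin n)), P = convexHull ℝ (S : Set (EuclideanSpace ℝ (Fin n)))

/-- A `d`-polytope: a nonempty polytope whose affine hull has dimension `d`. -/
def IsDPolytope {n : ℕ} (d : ℕ) (P : Set (EuclideanSpace ℝ (Fin n))) : Prop :=
  IsPolytope P ∧ P.Nonempty ∧ Module.finrank ℝ (affineSpan ℝ P).direction = d

/-- The graph `G(P)` of a polytope `P`. The faces of `P` are its exposed subsets (the sets of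
maximisers over `P` of a linear functional, and the empty set). The vertices of the graph are the
points `v` such that `{v}` is a face of `P`; two distinct vertices `v`, `w` are adjacent when the
segment `[v, w]` is a face (an edge) of `P`. -/
def polytopeGraph {n : ℕ} (P : Set (EuclideanSpace ℝ (Fin n))) :
    SimpleGraph {v : EuclideanSpace ℝ (Fin n) // v ∈ P ∧ IsExposed ℝ P {v}} where
  Adj v w := v ≠ w ∧ IsExposed ℝ P (segment ℝ v.1 w.1)
  symm := ⟨fun v w h => ⟨h.1.symm, segment_symm ℝ v.1 w.1 ▸ h.2⟩⟩
  loopless := ⟨fun _ h => h.1 rfl⟩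

/-- `k`-linkedness of a graph: it has at least `2k` vertices and, for all `2k` pairwise distinct
vertices `s₁, …, sₖ, t₁, …, tₖ` (that is, for every pairing of every set of exactly `2k`
vertices), there are pairwise vertex-disjoint paths joining `sᵢ` to `tᵢ`. -/
def SimpleGraph.IsKLinked {V : Type*} (G : SimpleGraph V) (k : ℕ) : Prop :=
  ((2 * k : ℕ) : ℕ∞) ≤ ENat.card V ∧
    ∀ s t : Fin k → V, Function.Injective (Sum.elim s t) →
      ∃ p : (i : Fin k) → G.Walk (s i) (t i),
        (∀ i, (p i).IsPath) ∧
        ∀ i j, i ≠ j → List.Disjoint (p i).support (p j).support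

/-!
Let `s₀, t₀, s₁, t₁` be four vertices. Asking a linear functional `f` to satisfy `f s₀ = f t₀`,
`f s₁ = f t₁` and to take at `s₀` its mean over all vertices imposes three linear conditions, so in
dimension at least four such an `f` can be chosen nonconstant on `P`. Up to replacing `f` by `-f`,
the hyperplane `f = f s₀` weakly separates `s₀, t₀` from `s₁, t₁`, and because of the mean condition
there are vertices strictly on both sides. The simplex method with a generic objective close to `f`
shows that the vertices strictly on one side induce a connected subgraph, and one step of the
simplex method leads from a vertex on the hyperplane into either side. Hence `s₀, t₀` can be joined
on one side and `s₁, t₁` on the other.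
-/

open Set Filter Topology

section LinearFunctional

variable {E : Type*} [AddCommGroup E]

theorem exists_dual_splitting {K ι : Type*} [Field K] [LinearOrder K] [IsStrictOrderedRing K]
    [Module K E] [Finite ι] (p : ι → E) (hp : 3 < Module.finrank K (vectorSpan K (range p)))
    (a b a' b' : E) :
    ∃ f : Module.Dual K E, f b = f a ∧ f b' = f a' ∧ f a' ≤ f a ∧
      (∃ i, f a < f (p i)) ∧ ∃ i, f (p i) < f a := by
  classical
  have := Fintype.ofFinite ι
  let D : Finset E := {b - a, b' - a', ∑ i, (p i - a)}
  obtain ⟨j, hj⟩ : ∃ j, p j - a ∉ Submodule.span K (D : Set E) := by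
    by_contra! h
    have hle : vectorSpan K (range p) ≤ Submodule.span K (D : Set E) := by
      rw [vectorSpan_def, Submodule.span_le]
      rintro _ ⟨_, ⟨i, rfl⟩, _, ⟨k, rfl⟩, rfl⟩
      simpa using sub_mem (h i) (h k)
    have hD : Module.finrank K (Submodule.span K (D : Set E)) ≤ 3 :=
      (finrank_span_finset_le_card D).trans Finset.card_le_three
    exact (hp.trans_le (Submodule.finrank_mono hle)).not_ge hD
  obtain ⟨f, hfj, hfD⟩ := Submodule.exists_le_ker_of_notMem hj
  have hker : ∀ d ∈ D, f d = 0 := fun d hd => hfD (Submodule.subset_span hd)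
  wlog hle : f a' ≤ f a generalizing f
  · exact this (-f) (by rwa [LinearMap.neg_apply, neg_ne_zero]) (by rwa [LinearMap.ker_neg])
      (fun d hd => by simp [hker d hd]) (by simpa using (not_le.1 hle).le)
  have hmean : ∑ i, (f (p i) - f a) = 0 := by
    simpa only [map_sum, map_sub] using hker (∑ i, (p i - a)) (by simp [D])
  rw [map_sub] at hfj
  obtain ⟨i, -, hi⟩ :=
    Finset.exists_pos_of_sum_zero_of_exists_nonzero _ hmean ⟨j, Finset.mem_univ j, hfj⟩
  obtain ⟨k, -, hk⟩ :=
    Finset.exists_pos_of_sum_zero_of_exists_nonzero (s := Finset.univ) (fun i => f a - f (p i))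
      (by simpa using congrArg Neg.neg hmean)
      ⟨j, Finset.mem_univ j, sub_ne_zero.2 (sub_ne_zero.1 hfj).symm⟩
  refine ⟨f, ?_, ?_, hle, ⟨i, sub_pos.1 hi⟩, k, sub_pos.1 hk⟩
  · simpa [sub_eq_zero] using hker (b - a) (by simp [D])
  · simpa [sub_eq_zero] using hker (b' - a') (by simp [D])

variable [Module ℝ E] [TopologicalSpace E] [SeparatingDual ℝ E]

theorem exists_strongDual_forall_ne_zero {D : Set E} (hD : D.Finite) :
    ∃ g : StrongDual ℝ E, ∀ d ∈ D, d ≠ 0 → g d ≠ 0 := by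
  have : Finite {d | d ∈ D ∧ d ≠ 0} := hD.subset fun _ h => h.1
  obtain ⟨g, hg⟩ := Module.Dual.exists_forall_ne_zero_of_forall_exists
    (fun d : {d | d ∈ D ∧ d ≠ 0} => (topDualPairing ℝ E).flip d)
    fun d => SeparatingDual.exists_ne_zero d.2.2
  exact ⟨g, fun d hd hd0 => hg ⟨d, hd, hd0⟩⟩

theorem exists_strongDual_perturbation (l : StrongDual ℝ E) {D : Set E} (hD : D.Finite) :
    ∃ g : StrongDual ℝ E, ∀ d ∈ D, (d ≠ 0 → g d ≠ 0) ∧ (0 < l d → 0 < g d) := by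
  obtain ⟨h, hh⟩ := exists_strongDual_forall_ne_zero hD
  have hev : ∀ d ∈ D, ∀ᶠ ε : ℝ in 𝓝[≠] 0,
      (d ≠ 0 → l d + ε * h d ≠ 0) ∧ (0 < l d → 0 < l d + ε * h d) := by
    intro d hd
    have hlim : Tendsto (fun ε : ℝ => l d + ε * h d) (𝓝[≠] 0) (𝓝 (l d)) := by
      refine tendsto_nhdsWithin_of_tendsto_nhds ?_
      exact Continuous.tendsto' (by fun_prop) _ _ (by simp)
    by_cases hld : l d = 0
    · filter_upwards [self_mem_nhdsWithin] with ε hε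
      simpa [hld] using fun hd0 => And.intro hε (hh d hd hd0)
    · filter_upwards [hlim.eventually_ne hld,
        eventually_imp_distrib_left.2 hlim.eventually_const_lt] with ε hne hpos
      exact ⟨fun _ => hne, hpos⟩
  obtain ⟨ε, hε⟩ := ((eventually_all_finite hD).2 hev).exists
  exact ⟨l + ε • h, fun d hd => by simpa using hε d hd⟩

end LinearFunctional

section ConvexPosition

variable {E : Type*} [AddCommGroup E] [Module ℝ E] {V : Set E}

theorem eq_or_eq_of_mem_segment_of_convexIndependent (hV : ConvexIndependent ℝ ((↑) : V → E))
    {v w x : E} (hv : v ∈ V) (hw : w ∈ V) (hx : x ∈ V) (hmem : x ∈ segment ℝ v w) :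
    x = v ∨ x = w := by
  by_contra! hne
  refine convexIndependent_set_iff_notMem_convexHull_sdiff.1 hV x hx ?_
  exact segment_subset_convexHull (s := V \ {x}) ⟨hv, hne.1.symm⟩ ⟨hw, hne.2.symm⟩ hmem

theorem eq_of_smul_sub_eq_smul_sub_of_convexIndependent
    (hV : ConvexIndependent ℝ ((↑) : V → E)) {v w x : E} (hv : v ∈ V) (hw : w ∈ V) (hx : x ∈ V)
    (hwv : w ≠ v) (hxv : x ≠ v) {a b : ℝ} (ha : 0 < a) (hb : 0 < b)
    (h : a • (w - v) = b • (x - v)) : w = x := by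
  wlog hab : a ≤ b generalizing w x a b
  · exact (this hx hw hxv hwv hb ha h.symm (not_le.1 hab).le).symm
  have hxw : x = AffineMap.lineMap v w (a / b) := by
    rw [AffineMap.lineMap_apply_module', div_eq_inv_mul, mul_smul, h, inv_smul_smul₀ hb.ne']
    abel
  have hmem : x ∈ segment ℝ v w := by
    rw [segment_eq_image_lineMap]
    exact ⟨a / b, ⟨by positivity, (div_le_one hb).2 hab⟩, hxw.symm⟩
  exact ((eq_or_eq_of_mem_segment_of_convexIndependent hV hv hw hx hmem).resolve_left hxv).symm

variable [TopologicalSpace E]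

theorem isExposed_convexHull_of_forall_lt {K : Set E} {l : StrongDual ℝ E} {r : ℝ} (hKV : K ⊆ V)
    (hK : ∀ x ∈ K, l x = r) (hlt : ∀ x ∈ V, x ∉ K → l x < r) :
    IsExposed ℝ (convexHull ℝ V) (convexHull ℝ K) := by
  have hhull : ∀ x ∈ convexHull ℝ K, l x = r :=
    convexHull_min hK (convex_hyperplane l.isLinear r)
  have hconv : Convex ℝ ({x | l x < r} ∪ convexHull ℝ K) := by
    refine convex_iff_forall_pos.2 fun x hx y hy a b ha hb hab => ?_
    have hcombo : r - l (a • x + b • y) = a * (r - l x) + b * (r - l y) := by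
      simp only [map_add, map_smul, smul_eq_mul]
      linear_combination -r * hab
    have hlt_of_pos : 0 < a * (r - l x) + b * (r - l y) →
        a • x + b • y ∈ {x | l x < r} ∪ convexHull ℝ K :=
      fun h => .inl (sub_pos.1 (hcombo ▸ h))
    rcases hx with hx | hx <;> rcases hy with hy | hy
    · exact hlt_of_pos (add_pos (mul_pos ha (sub_pos.2 hx)) (mul_pos hb (sub_pos.2 hy)))
    · exact hlt_of_pos (by simpa [hhull y hy, ha] using hx)
    · exact hlt_of_pos (by simpa [hhull x hx, hb] using hy)
    · exact .inr (convex_convexHull ℝ K hx hy ha.le hb.le hab)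
  have hsub : convexHull ℝ V ⊆ {x | l x < r} ∪ convexHull ℝ K := by
    refine convexHull_min (fun x hx => ?_) hconv
    by_cases hxK : x ∈ K
    exacts [.inr (subset_convexHull ℝ K hxK), .inl (hlt x hx hxK)]
  have hle : ∀ y ∈ convexHull ℝ V, l y ≤ r := fun y hy =>
    (hsub hy).elim (fun h => le_of_lt h) fun h => (hhull y h).le
  rintro ⟨z, hz⟩
  refine ⟨l, Subset.antisymm (fun x hx => ⟨convexHull_mono hKV hx, fun y hy => ?_⟩) ?_⟩
  · exact (hle y hy).trans_eq (hhull x hx).symm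
  · rintro x ⟨hx, hmax⟩
    refine (hsub hx).resolve_left fun hxr => ?_
    exact ((hmax z (convexHull_mono hKV hz)).trans_lt hxr).ne (hhull z hz)

variable [IsTopologicalAddGroup E] [ContinuousSMul ℝ E] [LocallyConvexSpace ℝ E] [T2Space E]

theorem exists_strongDual_forall_lt_of_convexIndependent (hfin : V.Finite)
    (hV : ConvexIndependent ℝ ((↑) : V → E)) {v : E} (hv : v ∈ V) :
    ∃ l : StrongDual ℝ E, ∀ w ∈ V, w ≠ v → l w < l v := by
  obtain ⟨l, r, hr, hrv⟩ := geometric_hahn_banach_closed_point (convex_convexHull ℝ (V \ {v}))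
    (hfin.sdiff.isClosed_convexHull ℝ)
    (convexIndependent_set_iff_notMem_convexHull_sdiff.1 hV v hv)
  exact ⟨l, fun w hw hwv => (hr w (subset_convexHull ℝ _ ⟨hw, hwv⟩)).trans hrv⟩

theorem exposedPoints_convexHull_of_convexIndependent (hfin : V.Finite)
    (hV : ConvexIndependent ℝ ((↑) : V → E)) : (convexHull ℝ V).exposedPoints ℝ = V := by
  refine Subset.antisymm
    (exposedPoints_subset_extremePoints.trans extremePoints_convexHull_subset) fun v hv => ?_
  obtain ⟨l, hl⟩ := exists_strongDual_forall_lt_of_convexIndependent hfin hV hv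
  rw [mem_exposedPoints_iff_exposed_singleton, ← convexHull_singleton (𝕜 := ℝ) v]
  exact isExposed_convexHull_of_forall_lt (singleton_subset_iff.2 hv) (by simp) hl

theorem convexHull_extremePoints_convexHull (hfin : V.Finite) :
    convexHull ℝ ((convexHull ℝ V).extremePoints ℝ) = convexHull ℝ V := by
  rw [← ((hfin.subset extremePoints_convexHull_subset).isClosed_convexHull ℝ).closure_eq,
    closure_convexHull_extremePoints (hfin.isCompact_convexHull ℝ) (convex_convexHull ℝ V)]

theorem exists_strongDual_injOn_slope (hfin : V.Finite) (hV : ConvexIndependent ℝ ((↑) : V → E))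
    (f : StrongDual ℝ E) {v : E} (hv : v ∈ V) :
    ∃ l : StrongDual ℝ E, (∀ w ∈ V, w ≠ v → l w < l v) ∧
      InjOn (fun x => (f x - f v) / (l v - l x)) {x ∈ V | f v < f x} := by
  obtain ⟨l₀, hl₀⟩ := exists_strongDual_forall_lt_of_convexIndependent hfin hV hv
  let δ : E → E → E := fun w x => (f x - f v) • (w - v) - (f w - f v) • (x - v)
  obtain ⟨l, hl⟩ := exists_strongDual_perturbation l₀
    ((hfin.image (v - ·)).union (hfin.image2 δ hfin))
  have hlv : ∀ w ∈ V, w ≠ v → l w < l v := by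
    intro w hw hwv
    have := (hl (v - w) (.inl (mem_image_of_mem _ hw))).2
    simp only [map_sub, sub_pos] at this
    exact this (hl₀ w hw hwv)
  refine ⟨l, hlv, fun w ⟨hw, hvw⟩ x ⟨hx, hvx⟩ hslope => ?_⟩
  have hwv : w ≠ v := fun h => (h ▸ hvw).false
  have hxv : x ≠ v := fun h => (h ▸ hvx).false
  have hδ : l (δ w x) = 0 := by
    rw [div_eq_div_iff (sub_pos.2 (hlv w hw hwv)).ne' (sub_pos.2 (hlv x hx hxv)).ne'] at hslope
    simp only [δ, map_sub, map_smul, smul_eq_mul]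
    linear_combination hslope
  have hδ0 : δ w x = 0 := not_imp_not.1 (hl _ (.inr (mem_image2_of_mem hw hx))).1 hδ
  exact eq_of_smul_sub_eq_smul_sub_of_convexIndependent hV hv hw hx hwv hxv (sub_pos.2 hvx)
    (sub_pos.2 hvw) (sub_eq_zero.1 hδ0)

/- With `l` exposing `v`, the vertices maximising the slope `(f x - f v) / (l v - l x)` form a face
together with `v`. Perturbing `l`, and not `f`, makes the maximiser unique: this face is an edge. -/
theorem exists_isExposed_segment_of_lt (hfin : V.Finite) (hV : ConvexIndependent ℝ ((↑) : V → E))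
    (f : StrongDual ℝ E) {v u : E} (hv : v ∈ V) (hu : u ∈ V) (hvu : f v < f u) :
    ∃ w ∈ V, f v < f w ∧ IsExposed ℝ (convexHull ℝ V) (segment ℝ v w) := by
  obtain ⟨l, hlv, hinj⟩ := exists_strongDual_injOn_slope hfin hV f hv
  set slope : E → ℝ := fun x => (f x - f v) / (l v - l x)
  obtain ⟨w, ⟨hw, hvw⟩, hmax⟩ := exists_max_image {x ∈ V | f v < f x} slope
    (hfin.subset (sep_subset _ _)) ⟨u, hu, hvu⟩
  have hlw : 0 < l v - l w := sub_pos.2 (hlv w hw fun h => (h ▸ hvw).false)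
  have hslope_pos : 0 < slope w := div_pos (sub_pos.2 hvw) hlw
  have hslope_w : slope w * (l v - l w) = f w - f v := div_mul_cancel₀ _ hlw.ne'
  have hlt : ∀ x ∈ V, x ∉ ({v, w} : Set E) → f x - f v < slope w * (l v - l x) := by
    intro x hx hxvw
    obtain ⟨hxv, hxw⟩ : x ≠ v ∧ x ≠ w := by simpa using hxvw
    have hlx : 0 < l v - l x := sub_pos.2 (hlv x hx hxv)
    rcases le_or_gt (f x) (f v) with hfx | hfx
    · exact (sub_nonpos.2 hfx).trans_lt (mul_pos hslope_pos hlx)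
    · exact (div_lt_iff₀ hlx).1 <| (hmax x ⟨hx, hfx⟩).lt_of_ne fun h =>
        hxw (hinj ⟨hx, hfx⟩ ⟨hw, hvw⟩ h)
  refine ⟨w, hw, hvw, ?_⟩
  rw [← convexHull_pair]
  refine isExposed_convexHull_of_forall_lt (l := f + slope w • l) (r := f v + slope w * l v)
    (pair_subset hv hw) ?_ fun x hx hxvw => ?_
  · simp only [mem_insert_iff, mem_singleton_iff, forall_eq_or_imp, forall_eq, add_apply,
      smul_apply, smul_eq_mul, true_and]
    linear_combination -hslope_w
  · simp only [add_apply, smul_apply, smul_eq_mul]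
    linarith [hlt x hx hxvw]

end ConvexPosition

theorem disjoint_insert_insert_of_lt {X α : Type*} [Preorder α] {g : X → α} {s t s' t' : X}
    (hss' : s ≠ s') (hst' : s ≠ t') (hts' : t ≠ s') (htt' : t ≠ t') (ht : g s ≤ g t)
    (hs' : g s' ≤ g s) (ht' : g t' ≤ g s) :
    Disjoint (insert s (insert t {x | g s < g x})) (insert s' (insert t' {x | g x < g s})) := by
  simp only [disjoint_insert_left, disjoint_insert_right, mem_insert_iff, mem_ofPred_eq, not_or]
  exact ⟨⟨hss'.symm, hts'.symm, hs'.not_gt⟩, ⟨hst'.symm, htt'.symm, ht'.not_gt⟩, lt_irrefl _,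
    ht.not_gt, disjoint_left.2 fun _ h => h.not_gt⟩

section Graph

variable {V : Type*} {G : SimpleGraph V}

theorem preconnected_of_forall_exists_adj_lt {α : Type*} [Finite V] [LinearOrder α] {g : V → α}
    (hinj : g.Injective) (hadj : ∀ v w, g v < g w → ∃ u, G.Adj v u ∧ g v < g u) :
    G.Preconnected := by
  have hpeak : ∀ v, ∃ m, G.Reachable v m ∧ ∀ w, g w ≤ g m := by
    intro v
    obtain ⟨m, hvm, hmax⟩ := exists_max_image {x | G.Reachable v x} g (toFinite _) ⟨v, .rfl⟩
    refine ⟨m, hvm, fun w => not_lt.1 fun hmw => ?_⟩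
    obtain ⟨u, hmu, hlt⟩ := hadj m w hmw
    exact (hmax u (hvm.trans hmu.reachable)).not_gt hlt
  intro v w
  obtain ⟨m, hvm, hm⟩ := hpeak v
  obtain ⟨m', hwm, hm'⟩ := hpeak w
  obtain rfl : m = m' := hinj (le_antisymm (hm' m) (hm m'))
  exact hvm.trans hwm.symm

theorem connected_induce_insert {A : Set V} (hA : (G.induce A).Connected) {v : V}
    (hv : v ∈ A ∨ ∃ w ∈ A, G.Adj v w) : (G.induce (insert v A)).Connected := by
  rcases hv with hv | ⟨w, hw, hvw⟩
  · rwa [insert_eq_of_mem hv]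
  · exact SimpleGraph.connected_induce_union (s := {v})
      (fun x y => by rw [Subsingleton.elim x y]) hA.preconnected (mem_singleton v) hw hvw

theorem isKLinked_of_preconnected_induce {k : ℕ} (hcard : ((2 * k : ℕ) : ℕ∞) ≤ ENat.card V)
    (h : ∀ s t : Fin k → V, (Sum.elim s t).Injective → ∃ A : Fin k → Set V,
      Pairwise (Function.onFun Disjoint A) ∧
        ∀ i, s i ∈ A i ∧ t i ∈ A i ∧ (G.induce (A i)).Preconnected) :
    G.IsKLinked k := by
  classical
  refine ⟨hcard, fun s t hst => ?_⟩
  obtain ⟨A, hdisj, hA⟩ := h s t hst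
  have hpath : ∀ i, ∃ p : G.Walk (s i) (t i), p.IsPath ∧ ∀ x ∈ p.support, x ∈ A i := by
    intro i
    obtain ⟨hs, ht, hpre⟩ := hA i
    obtain ⟨p, hp⟩ := (hpre ⟨s i, hs⟩ ⟨t i, ht⟩).exists_isPath
    refine ⟨p.map (SimpleGraph.Embedding.induce (A i)).toHom,
      hp.map Subtype.val_injective, fun x hx => ?_⟩
    obtain ⟨y, -, rfl⟩ := List.mem_map.1 (p.support_map _ ▸ hx)
    exact y.2
  choose p hp hpA using hpath
  exact ⟨p, hp, fun i j hij x hi hj => (hdisj hij).notMem_of_mem_left (hpA i x hi) (hpA j x hj)⟩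

end Graph

section PolytopeGraph

variable {n d : ℕ} {P : Set (EuclideanSpace ℝ (Fin n))}

/-- The vertices of `P`, as the vertex type of `polytopeGraph P`. -/
abbrev PolytopeVertex (P : Set (EuclideanSpace ℝ (Fin n))) : Type :=
  {v : EuclideanSpace ℝ (Fin n) // v ∈ P ∧ IsExposed ℝ P {v}}

theorem range_coe_polytopeVertex :
    range ((↑) : PolytopeVertex P → EuclideanSpace ℝ (Fin n)) = P.exposedPoints ℝ := by
  ext v
  simpa [mem_exposedPoints_iff_exposed_singleton] using fun h => h.subset rfl

namespace IsPolytope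

theorem exists_convexIndependent (hP : IsPolytope P) :
    ∃ V : Set (EuclideanSpace ℝ (Fin n)), V.Finite ∧
      ConvexIndependent ℝ ((↑) : V → EuclideanSpace ℝ (Fin n)) ∧ convexHull ℝ V = P := by
  obtain ⟨S, rfl⟩ := hP
  exact ⟨_, S.finite_toSet.subset extremePoints_convexHull_subset,
    (convex_convexHull ℝ _).convexIndependent_extremePoints,
    convexHull_extremePoints_convexHull S.finite_toSet⟩

theorem finite_exposedPoints (hP : IsPolytope P) : (P.exposedPoints ℝ).Finite := by
  obtain ⟨V, hfin, hV, rfl⟩ := hP.exists_convexIndependent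
  rwa [exposedPoints_convexHull_of_convexIndependent hfin hV]

theorem convexHull_exposedPoints (hP : IsPolytope P) : convexHull ℝ (P.exposedPoints ℝ) = P := by
  obtain ⟨V, hfin, hV, rfl⟩ := hP.exists_convexIndependent
  rw [exposedPoints_convexHull_of_convexIndependent hfin hV]

theorem finite_vertex (hP : IsPolytope P) : Finite (PolytopeVertex P) :=
  hP.finite_exposedPoints.subset fun _ h => mem_exposedPoints_iff_exposed_singleton.2 h.2

theorem exists_adj_of_lt (hP : IsPolytope P) (f : StrongDual ℝ (EuclideanSpace ℝ (Fin n)))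
    {v u : PolytopeVertex P} (hvu : f v < f u) :
    ∃ w, (polytopeGraph P).Adj v w ∧ f v < f w := by
  obtain ⟨V, hfin, hV, rfl⟩ := hP.exists_convexIndependent
  have hmem : ∀ x, x ∈ V ↔ IsExposed ℝ (convexHull ℝ V) {x} := fun x => by
    rw [← mem_exposedPoints_iff_exposed_singleton,
      exposedPoints_convexHull_of_convexIndependent hfin hV]
  obtain ⟨w, hw, hvw, hedge⟩ := exists_isExposed_segment_of_lt hfin hV f ((hmem _).2 v.2.2)
    ((hmem _).2 u.2.2) hvu
  exact ⟨⟨w, subset_convexHull ℝ V hw, (hmem w).1 hw⟩,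
    ⟨fun h => (h ▸ hvw).false, hedge⟩, hvw⟩

theorem preconnected_induce_halfSpace (hP : IsPolytope P)
    (f : StrongDual ℝ (EuclideanSpace ℝ (Fin n))) (c : ℝ) :
    ((polytopeGraph P).induce {v : PolytopeVertex P | c < f v}).Preconnected := by
  have := hP.finite_vertex
  obtain ⟨g, hg⟩ := exists_strongDual_perturbation f
    (toFinite (range fun e : PolytopeVertex P × PolytopeVertex P => e.1.1 - e.2.1))
  have hgsub : ∀ v w : PolytopeVertex P,
      (v.1 - w.1 ≠ 0 → g v - g w ≠ 0) ∧ (f w < f v → g w < g v) := fun v w => by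
    simpa only [map_sub, sub_pos] using hg _ (mem_range_self (v, w))
  have hinj : (fun v : {v : PolytopeVertex P | c < f v} => g v).Injective := fun v w h =>
    Subtype.ext <| Subtype.ext <| sub_eq_zero.1 <|
      not_imp_not.1 (hgsub v w).1 (sub_eq_zero.2 h)
  refine preconnected_of_forall_exists_adj_lt hinj fun v w hvw => ?_
  obtain ⟨u, hadj, hvu⟩ := hP.exists_adj_of_lt g hvw
  have hfvu : f v ≤ f u := not_lt.1 fun h => ((hgsub v u).2 h).asymm hvu
  exact ⟨⟨u, v.2.trans_le hfvu⟩, hadj, hvu⟩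

theorem preconnected_induce_insert_insert_halfSpace (hP : IsPolytope P)
    (f : StrongDual ℝ (EuclideanSpace ℝ (Fin n))) {c : ℝ} {s t u : PolytopeVertex P}
    (hs : c ≤ f s) (ht : c ≤ f t) (hu : c < f u) :
    ((polytopeGraph P).induce
      (insert s (insert t {v : PolytopeVertex P | c < f v}))).Preconnected := by
  have hstep : ∀ v : PolytopeVertex P, c ≤ f v →
      c < f v ∨ ∃ w : PolytopeVertex P, c < f w ∧ (polytopeGraph P).Adj v w := by
    intro v hv
    refine hv.lt_or_eq.imp_right ?_
    rintro rfl
    obtain ⟨w, hadj, hvw⟩ := hP.exists_adj_of_lt f hu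
    exact ⟨w, hvw, hadj⟩
  have hconn : ((polytopeGraph P).induce {v : PolytopeVertex P | c < f v}).Connected :=
    { preconnected := hP.preconnected_induce_halfSpace f c, nonempty := ⟨u, hu⟩ }
  refine (connected_induce_insert (connected_induce_insert hconn (hstep t ht)) ?_).preconnected
  exact (hstep s hs).imp .inr fun ⟨w, hw, hadj⟩ => ⟨w, .inr hw, hadj⟩

end IsPolytope

namespace IsDPolytope

theorem finrank_vectorSpan_vertices (hP : IsDPolytope d P) :
    Module.finrank ℝ (vectorSpan ℝ
      (range ((↑) : PolytopeVertex P → EuclideanSpace ℝ (Fin n)))) = d := by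
  rw [range_coe_polytopeVertex, ← direction_affineSpan, ← affineSpan_convexHull,
    hP.1.convexHull_exposedPoints, hP.2.2]

theorem lt_card_vertices (hP : IsDPolytope d P) : d < ENat.card (PolytopeVertex P) := by
  have := hP.1.finite_vertex
  have := Fintype.ofFinite (PolytopeVertex P)
  have : Nonempty (PolytopeVertex P) := by
    rw [← range_nonempty_iff_nonempty (f := Subtype.val), range_coe_polytopeVertex,
      ← convexHull_nonempty_iff (𝕜 := ℝ), hP.1.convexHull_exposedPoints]
    exact hP.2.1
  have hcard := finrank_vectorSpan_range_add_one_le ℝ (Subtype.val : PolytopeVertex P → _)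
  rw [hP.finrank_vectorSpan_vertices] at hcard
  rw [ENat.card_eq_coe_fintype_card]
  exact_mod_cast hcard

theorem exists_disjoint_preconnected_induce (hP : IsDPolytope d P) (hd : 4 ≤ d)
    {s t s' t' : PolytopeVertex P} (hss' : s ≠ s') (hst' : s ≠ t') (hts' : t ≠ s')
    (htt' : t ≠ t') :
    ∃ A B : Set (PolytopeVertex P), Disjoint A B ∧
      (s ∈ A ∧ t ∈ A ∧ ((polytopeGraph P).induce A).Preconnected) ∧
      (s' ∈ B ∧ t' ∈ B ∧ ((polytopeGraph P).induce B).Preconnected) := by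
  have := hP.1.finite_vertex
  obtain ⟨f₀, ht, ht', hs', ⟨u, hu⟩, u', hu'⟩ := exists_dual_splitting
    (Subtype.val : PolytopeVertex P → _) (hd.trans_eq hP.finrank_vectorSpan_vertices.symm)
    s.1 t.1 s'.1 t'.1
  obtain ⟨f, rfl⟩ : ∃ f : StrongDual ℝ (EuclideanSpace ℝ (Fin n)), f.toLinearMap = f₀ :=
    ⟨f₀.toContinuousLinearMap, rfl⟩
  simp only [ContinuousLinearMap.coe_coe] at ht ht' hs' hu hu'
  have hA := hP.1.preconnected_induce_insert_insert_halfSpace f (c := f s) le_rfl ht.ge hu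
  have hB := hP.1.preconnected_induce_insert_insert_halfSpace (-f) (c := -f s) (s := s') (t := t')
    (u := u') (neg_le_neg hs') (neg_le_neg (ht'.trans_le hs')) (neg_lt_neg hu')
  refine ⟨_, _, ?_, ⟨mem_insert _ _, mem_insert_of_mem _ (mem_insert _ _), hA⟩,
    mem_insert _ _, mem_insert_of_mem _ (mem_insert _ _), hB⟩
  rw [show {v : PolytopeVertex P | -f s < (-f) v} =
      {v : PolytopeVertex P | f v < f s} by ext v; simp]
  exact disjoint_insert_insert_of_lt (g := fun v : PolytopeVertex P => f v) hss' hst' hts' htt'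
    ht.ge hs' (ht'.trans_le hs')

end IsDPolytope

end PolytopeGraph

theorem mainTheorem8_general (n d : ℕ) (hd : 4 ≤ d) (P : Set (EuclideanSpace ℝ (Fin n)))
    (hP : IsDPolytope d P) : (polytopeGraph P).IsKLinked 2 := by
  refine isKLinked_of_preconnected_induce ?_ fun s t hst => ?_
  · exact (Nat.cast_le.2 hd).trans hP.lt_card_vertices.le
  · obtain ⟨A, B, hAB, hA, hB⟩ := hP.exists_disjoint_preconnected_induce hd
      (hst.ne (a₁ := .inl 0) (a₂ := .inl 1) (by simp))
      (hst.ne (a₁ := .inl 0) (a₂ := .inr 1) (by simp))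
      (hst.ne (a₁ := .inr 0) (a₂ := .inl 1) (by simp))
      (hst.ne (a₁ := .inr 0) (a₂ := .inr 1) (by simp))
    refine ⟨![A, B], ?_, Fin.forall_fin_two.2 ⟨hA, hB⟩⟩
    simp [Pairwise, Function.onFun, Fin.forall_fin_two, hAB, hAB.symm]

theorem mainTheorem8 (n : ℕ) (P : Set (EuclideanSpace ℝ (Fin n))) (hP : IsDPolytope 4 P) :
    (polytopeGraph P).IsKLinked 2 :=
  mainTheorem8_general n 4 le_rfl P hP
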